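/- Let $\mathbf A$ be an algebra, i.e. a non-empty set $A$ with a (possibly infinite) family of finitary operations. The height of a term is defined inductively: a variable has height $0$, and $f(t_1,\dots,t_k)$ has height $1+\max_i \operatorname{ht}(t_i)$, where $\max\emptyset=0$, so that a nullary operation symbol has height $1$. The height of a term operation $t^{\mathbf A}$ is the least height of a term $s$ with $s^{\mathbf A}=t^{\mathbf A}$, and $\operatorname{Ht}_{\mathbf A}(n)$ is the maximum of the heights of all $n$-ary term operations of $\mathbf A$. For congruences $\alpha_1,\dots,\alpha_m,\beta$ of $\mathbf A$, the higher commutator $[\alpha_1,\dots,\alpha_m,\beta]$ is the smallest congruence $\delta$ of $\mathbf A$ with the following property: for every term $t$ and all tuples $\mathbf a_i,\mathbf b_i$ that are congruent modulo $\alpha_i$ coordinatewise and $\mathbf u,\mathbf v$ that are congruent modulo $\beta$ coordinatewise, if $t(\mathbf x_1,\dots,\mathbf x_m,\mathbf u)\equiv_\delta t(\mathbf x_1,\dots,\mathbf x_m,\mathbf v)$ for all $(\mathbf x_1,\dots,\mathbf x_m)\in\prod_i\{\mathbf a_i,\mathbf b_i\}$ other than $(\mathbf b_1,\dots,\mathbf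 b_m)$, then $t(\mathbf b_1,\dots,\mathbf b_m,\mathbf u)\equiv_\delta t(\mathbf b_1,\dots,\mathbf b_m,\mathbf v)$. The algebra $\mathbf A$ is supernilpotent if for some $d\ge 1$ the commutator $[1_{\mathbf A},\dots,1_{\mathbf A}]$ of arity $d+1$ is $0_{\mathbf A}$, where $1_{\mathbf A}$ and $0_{\mathbf A}$ are the largest and the smallest congruence. It is a Mal'cev algebra if it has a ternary term $q$ with $q^{\mathbf A}(x,y,y)=x$ and $q^{\mathbf A}(x,x,y)=y$ for all $x,y\in A$. **Theorem.** Let $\mathbf A$ be a finite supernilpotent Mal'cev algebra. Then there exist positive real numbers $c_1,c_2$ such that $\operatorname{Ht}_{\mathbf A}(n)\le c_1\log n+c_2$ for all integers $n\ge 1$, where $\log$ is the natural logarithm. -/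

import Mathlib

/-!
Algebras are structures `A` over a language `L` without relation symbols; `L` may have infinitely
many operation symbols.  An `n`-ary term is an element of `L.Term (Fin n)`.
-/

namespace SupernilpotentHeight

universe u v w x

/-- The height of a term: variables have height `0`, and `f(t₁, …, tₖ)` has height
`1 + max {height tᵢ}`, where `max ∅ = 0`, so that a nullary operation symbol has height `1`. -/
def height {L : FirstOrder.Language.{u, v}} {α : Type x} : L.Term α → ℕ
  | .var _ => 0
  | .func _ ts => 1 + Finset.univ.sup fun i => height (ts i)

section Algebra

variable (L : FirstOrder.Language.{u, v}) (A : Type w) [L.Structure A]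

/-- `Cloₙ A`, the set of `n`-ary term operations of `A`. -/
def termOps (n : ℕ) : Set ((Fin n → A) → A) :=
  {g | ∃ t : L.Term (Fin n), (fun a => t.realize a) = g}

variable {A} in
/-- The height of a term operation `g`: the least height of a term that induces `g`. -/
noncomputable def opHeight {n : ℕ} (g : (Fin n → A) → A) : ℕ :=
  sInf {h | ∃ s : L.Term (Fin n), (fun a => s.realize a) = g ∧ height s = h}

/-- `Ht_A(n)`, the maximum of the heights of the `n`-ary term operations of `A`. (On a finite
algebra the maximum exists for every `n ≥ 1`, see `maxHeight_isGreatest`.) -/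
noncomputable def maxHeight (n : ℕ) : ℕ :=
  sSup (opHeight L '' termOps L A n)

theorem maxHeight_isGreatest [Finite A] {n : ℕ} (hn : 0 < n) :
    IsGreatest (opHeight L '' termOps L A n) (maxHeight L A n) := by
  have hfin : (opHeight L '' termOps L A n).Finite := (Set.toFinite _).image _
  have hne : (opHeight L '' termOps L A n).Nonempty :=
    Set.Nonempty.image _ ⟨_, .var ⟨0, hn⟩, rfl⟩
  exact ⟨Nat.sSup_mem hne hfin.bddAbove, fun _ h => le_csSup hfin.bddAbove h⟩

variable {A}

/-- An equivalence relation is a congruence if it is compatible with every basic operation. -/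
def IsCongruence (r : Setoid A) : Prop :=
  ∀ ⦃k : ℕ⦄ (f : L.Functions k) (x y : Fin k → A), (∀ i, r (x i) (y i)) →
    r (FirstOrder.Language.Structure.funMap f x) (FirstOrder.Language.Structure.funMap f y)

/-- For a family of pairs of tuples `aᵢ`, `bᵢ`, the family that consists of `bᵢ` for `i ∈ S` and
of `aᵢ` for `i ∉ S`. -/
def choice {n : ℕ} {k : Fin n → ℕ} (a b : ∀ i, Fin (k i) → A) (S : Finset (Fin n)) :
    (Σ i, Fin (k i)) → A :=
  fun p => if p.1 ∈ S then b p.1 p.2 else a p.1 p.2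

/-- `α₁, …, αₙ` centralize `β` modulo `δ`: for all terms `t` and all tuples `aᵢ ≡ bᵢ` modulo `αᵢ`,
`u ≡ v` modulo `β`, if `t(x₁, …, xₙ, u) ≡ t(x₁, …, xₙ, v)` modulo `δ` for all choices of
`xᵢ ∈ {aᵢ, bᵢ}` other than `(b₁, …, bₙ)`, then also for `(x₁, …, xₙ) = (b₁, …, bₙ)`.
(Parameters from `A` are covered by the coordinates in which `u` and `v` agree.) -/
def Centralizes {n : ℕ} (α : Fin n → Setoid A) (β δ : Setoid A) : Prop :=
  ∀ (k : Fin n → ℕ) (m : ℕ) (a b : ∀ i, Fin (k i) → A) (u v : Fin m → A),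
    (∀ i j, α i (a i j) (b i j)) → (∀ j, β (u j) (v j)) →
    ∀ t : L.Term ((Σ i, Fin (k i)) ⊕ Fin m),
      (∀ S : Finset (Fin n), S ≠ Finset.univ →
        δ (t.realize (Sum.elim (choice a b S) u)) (t.realize (Sum.elim (choice a b S) v))) →
      δ (t.realize (Sum.elim (choice a b Finset.univ) u))
        (t.realize (Sum.elim (choice a b Finset.univ) v))

/-- The higher commutator `[α₁, …, αₙ, β]`, of arity `n + 1`: the smallest congruence `δ` such
that `α₁, …, αₙ` centralize `β` modulo `δ`. -/
noncomputable def higherCommutator {n : ℕ} (α : Fin n → Setoid A) (β : Setoid A) : Setoid A :=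
  sInf {δ | IsCongruence L δ ∧ Centralizes L α β δ}

theorem higherCommutator_isLeast {n : ℕ} (α : Fin n → Setoid A) (β : Setoid A) :
    IsLeast {δ | IsCongruence L δ ∧ Centralizes L α β δ} (higherCommutator L α β) := by
  refine ⟨⟨?_, ?_⟩, fun δ hδ => sInf_le hδ⟩
  · intro k f x y h δ hδ
    exact hδ.1 f x y fun i => h i δ hδ
  · intro k m a b u v hab huv t h δ hδ
    exact hδ.2 k m a b u v hab huv t fun S hS => h S hS δ hδ

variable (A)

/-- `A` is supernilpotent of degree `d` if `[1, …, 1] = 0` for the commutator of arity `d + 1`. -/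
def IsSupernilpotentOfDegree (d : ℕ) : Prop :=
  higherCommutator L (fun _ : Fin d => (⊤ : Setoid A)) ⊤ = ⊥

/-- `A` is supernilpotent (of some degree `d ≥ 1`). -/
def IsSupernilpotent : Prop :=
  ∃ d : ℕ, 1 ≤ d ∧ IsSupernilpotentOfDegree L A d

/-- `A` is a Mal'cev algebra: it has a term `q` with `q(x, y, y) = x` and `q(x, x, y) = y`. -/
def IsMalcev : Prop :=
  ∃ q : L.Term (Fin 3), ∀ x y : A, q.realize ![x, y, y] = x ∧ q.realize ![x, x, y] = y

end Algebra

end SupernilpotentHeight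

/-!
Let `A` be supernilpotent of degree `d` with Mal'cev term `q`, and let `ι` have `d + 1` elements.
From `q` one builds a term `Q` in variables indexed by the proper subsets of `ι` such that
`Q(x) = x_{ι \ {i}}` whenever `x` does not change in direction `i`, that is,
`x_T = x_{T ∪ {i}}` for all `T ∌ i` with `T ∪ {i} ≠ ι` (`IsMalcev.exists_cubeTerm`). If the
variables of a term `t` are split into `d + 1` blocks, and `c_S` is the value of `t` at the point
that agrees with `b` on the blocks in `S` and with `a` on the others, then the vanishing of the
`(d + 1)`-ary commutator forces `c_ι = Q(c_T : T ≠ ι)` (`realize_cubeTerm`).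

Apply this to an `n`-ary term operation with blocks of nearly equal size, and with all entries of
`a` equal to the first argument. Each `c_T` with `T ≠ ι` then depends on at most
`n - ⌊n / (d + 1)⌋ + 1` variables, so that
`Ht(n) ≤ height Q + Ht(n - ⌊n / (d + 1)⌋ + 1)` (`maxHeight_le_add_maxHeight`): a fixed increment
of the height pays for shrinking `n` by a constant factor, which gives logarithmic growth.
-/

namespace SupernilpotentHeight

open FirstOrder FirstOrder.Language

/-! ### Heights and substitution -/

section Height

variable {L : FirstOrder.Language}

theorem height_relabel {α β : Type*} (g : α → β) (t : L.Term α) :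
    height (t.relabel g) = height t := by
  induction t with
  | var => rfl
  | func f ts ih => simp only [Term.relabel, height, ih]

theorem height_subst_le {α β : Type*} (t : L.Term α) (s : α → L.Term β) {B : ℕ}
    (hs : ∀ v, height (s v) ≤ B) : height (t.subst s) ≤ height t + B := by
  induction t with
  | var v => simpa only [Term.subst, height, zero_add] using hs v
  | func f ts ih =>
    simp only [Term.subst, height, add_assoc]
    refine Nat.add_le_add_left (Finset.sup_le fun i _ => (ih i).trans ?_) 1
    exact Nat.add_le_add_right (Finset.le_sup (f := fun i => height (ts i)) (Finset.mem_univ i)) B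

theorem exists_height_le_maxHeight {A : Type*} [L.Structure A] [Finite A] {n : ℕ} (hn : 0 < n)
    (t : L.Term (Fin n)) : ∃ s : L.Term (Fin n),
      (∀ a : Fin n → A, s.realize a = t.realize a) ∧ height s ≤ maxHeight L A n := by
  obtain ⟨s, hs, h⟩ := Nat.sInf_mem
    (s := {h | ∃ s : L.Term (Fin n), (fun a : Fin n → A => s.realize a) = (fun a => t.realize a) ∧
      height s = h}) ⟨_, t, rfl, rfl⟩
  exact ⟨s, congrFun hs, h.trans_le ((maxHeight_isGreatest L A hn).2 ⟨_, ⟨t, rfl⟩, rfl⟩)⟩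

end Height

/-! ### Completing cubes -/

section Cube

variable {L : FirstOrder.Language} {A : Type*} [L.Structure A]

/-- A Mal'cev algebra has, for every non-empty finite set `I`, a term `Q` whose variables are the
proper subsets of `I` and which returns `x_{I \ {i}}` on every family `x` that does not change in
some direction `i ∈ I`. That only proper subsets occur is expressed by the values of `Q`, which do
not depend on the other variables. The term for `insert j I` is
`q(x_I, Q(x_T)_{T ⊂ I}, Q(x_{T ∪ {j}})_{T ⊂ I})`, where `Q` is the term for `I`. -/
theorem IsMalcev.exists_cubeTerm (hM : IsMalcev L A) {ι : Type*} [DecidableEq ι]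
    {I : Finset ι} (hI : I.Nonempty) : ∃ Q : L.Term (Finset ι),
      (∀ x y : Finset ι → A, (∀ T, T ⊂ I → x T = y T) → Q.realize x = Q.realize y) ∧
      ∀ x : Finset ι → A, ∀ i ∈ I, (∀ T, i ∉ T → insert i T ⊂ I → x T = x (insert i T)) →
        Q.realize x = x (I.erase i) := by
  obtain ⟨q, hq⟩ := hM
  induction hI using Finset.Nonempty.cons_induction with
  | singleton j =>
    refine ⟨.var ∅, fun x y h => h ∅ ?_, ?_⟩
    · simp
    · intro x i hi _
      rw [Finset.mem_singleton.1 hi]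
      simp
  | cons j I hj hI ih =>
    obtain ⟨Q, hdep, hQ⟩ := ih
    rw [Finset.cons_eq_insert]
    have key : ∀ x : Finset ι → A,
        (q.subst ![.var I, Q, Q.relabel (insert j)]).realize x =
          q.realize ![x I, Q.realize x, Q.realize fun T => x (insert j T)] := by
      intro x
      rw [Term.realize_subst]
      congr 1
      funext k
      fin_cases k <;> simp [Function.comp_def]
    have hsub : ∀ T, T ⊂ I → insert j T ⊂ insert j I := fun T hT =>
      (Finset.insert_subset_insert j hT.subset).ssubset_of_ne fun h => hT.ne <| by
        rw [← Finset.erase_insert (fun h => hj (hT.subset h)), h, Finset.erase_insert hj]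
    refine ⟨q.subst ![.var I, Q, Q.relabel (insert j)], fun x y h => ?_, fun x i hi h => ?_⟩
    · rw [key, key, h I (Finset.ssubset_insert hj),
        hdep x y fun T hT => h T (hT.trans (Finset.ssubset_insert hj)),
        hdep _ _ fun T hT => h _ (hsub T hT)]
    · rw [key]
      by_cases hij : i = j
      · subst hij
        rw [hdep (fun T => x (insert i T)) x fun T hT =>
          (h T (fun h => hj (hT.subset h)) (hsub T hT)).symm, (hq _ _).1, Finset.erase_insert hj]
      · have hiI : i ∈ I := (Finset.mem_insert.1 hi).resolve_left hij
        have h1 : Q.realize x = x I := by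
          rw [hQ x i hiI fun T hT hTI => h T hT (hTI.trans (Finset.ssubset_insert hj)),
            h _ (Finset.notMem_erase i I) (by
              rw [Finset.insert_erase hiI]; exact Finset.ssubset_insert hj),
            Finset.insert_erase hiI]
        rw [h1, (hq _ _).2, hQ _ i hiI fun T hT hTI => ?_]
        · rw [Finset.erase_insert_of_ne (Ne.symm hij)]
        · rw [Finset.insert_comm j i]
          refine h _ (by simp [hij, hT]) ?_
          rw [Finset.insert_comm i j]
          exact hsub _ hTI

/-- The tuple that agrees with `b` on the blocks in `S` and with `a` on the other blocks, where
the variable `v` belongs to the block `blk v`. -/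
def mix {V ι : Type*} [DecidableEq ι] (blk : V → ι) (a b : V → A) (S : Finset ι) : V → A :=
  fun v => if blk v ∈ S then b v else a v

/-- The condition `[1, …, 1] = 0` in terms of blocks: `none` is the block of the variables that
belong to the last argument of the commutator. -/
theorem IsSupernilpotentOfDegree.realize_mix_eq {d : ℕ} (h : IsSupernilpotentOfDegree L A d)
    {V : Type*} [Finite V] (t : L.Term V) (blk : V → Option (Fin d)) (a b : V → A)
    (ht : ∀ S : Finset (Fin d), S ≠ Finset.univ →
      t.realize (mix blk a b (S.map .some)) = t.realize (mix blk a b S.insertNone)) :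
    t.realize (mix blk a b (Finset.univ.map .some)) = t.realize (mix blk a b Finset.univ) := by
  have hc : Centralizes L (fun _ : Fin d => (⊤ : Setoid A)) ⊤ ⊥ := by
    have := (higherCommutator_isLeast L (fun _ : Fin d => (⊤ : Setoid A)) ⊤).1.2
    rwa [show higherCommutator L (fun _ : Fin d => (⊤ : Setoid A)) ⊤ = ⊥ from h] at this
  obtain ⟨N, ⟨e⟩⟩ := Finite.exists_equiv_fin V
  -- Every block gets its own copy of all the variables, of which it uses only its own.
  let ρ : V → (Σ _ : Fin d, Fin N) ⊕ Fin N := fun v =>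
    match blk v with
    | none => .inr (e v)
    | some i => .inl ⟨i, e v⟩
  have key1 : ∀ S : Finset (Fin d), Sum.elim (choice (k := fun _ => N)
      (fun _ j => a (e.symm j)) (fun _ j => b (e.symm j)) S) (fun j => a (e.symm j)) ∘ ρ =
        mix blk a b (S.map .some) := by
    intro S
    funext v
    rcases hv : blk v with _ | i <;> simp [ρ, mix, choice, hv]
  have key2 : ∀ S : Finset (Fin d), Sum.elim (choice (k := fun _ => N)
      (fun _ j => a (e.symm j)) (fun _ j => b (e.symm j)) S) (fun j => b (e.symm j)) ∘ ρ =
        mix blk a b S.insertNone := by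
    intro S
    funext v
    rcases hv : blk v with _ | i <;> simp [ρ, mix, choice, hv]
  have := hc (fun _ => N) N (fun _ j => a (e.symm j)) (fun _ j => b (e.symm j))
    (fun j => a (e.symm j)) (fun j => b (e.symm j)) (fun _ _ => trivial) (fun _ => trivial)
    (t.relabel ρ) (fun S hS => by
      rw [Term.realize_relabel, Term.realize_relabel, key1, key2, ht S hS])
  rw [Term.realize_relabel, Term.realize_relabel, key1, key2] at this
  have huniv : (Finset.univ : Finset (Fin d)).insertNone = Finset.univ := by
    ext o; cases o <;> simp
  rw [huniv] at this
  exact this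

/-- In a supernilpotent Mal'cev algebra the cube term computes the last vertex of a cube from the
others. The cube `e_S = Q(c_{S ∩ T})_T` agrees with `c` at all `S ≠ univ`, and the claim is that
the two cubes agree at `univ` as well. This follows from the term condition for the cube
`q(c_S, e_S, e_{S ∪ {none}})`, which at the vertices without and with `none` takes the values
`e_univ` and `c_univ` over the last edge, and equal values over every other edge. -/
theorem realize_cubeTerm {d : ℕ} (h : IsSupernilpotentOfDegree L A d) (hM : IsMalcev L A)
    {Q : L.Term (Finset (Option (Fin d)))}
    (hQ : ∀ x : Finset (Option (Fin d)) → A, ∀ i,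
      (∀ T, i ∉ T → insert i T ≠ Finset.univ → x T = x (insert i T)) →
        Q.realize x = x (Finset.univ.erase i))
    {V : Type*} [Finite V] (t : L.Term V) (blk : V → Option (Fin d)) (a b : V → A) :
    Q.realize (fun T => t.realize (mix blk a b T)) = t.realize b := by
  obtain ⟨q, hq⟩ := hM
  let c : Finset (Option (Fin d)) → A := fun S => t.realize (mix blk a b S)
  let e : Finset (Option (Fin d)) → A := fun S => Q.realize fun T => c (S ∩ T)
  have he : ∀ S, S ≠ Finset.univ → e S = c S := by
    intro S hS
    obtain ⟨i, hi⟩ : ∃ i, i ∉ S := by simpa [Finset.eq_univ_iff_forall] using hS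
    have : e S = c (S ∩ Finset.univ.erase i) := hQ _ i fun T _ _ => by
      rw [Finset.inter_insert_of_notMem hi]
    rw [this, Finset.inter_erase, Finset.inter_univ, Finset.erase_eq_of_notMem hi]
  -- The variable `(v, T, β)` replaces `v` in the copy of `t` at the variable `T` of `Q`, where
  -- `β` tells whether this copy lies in `e_{S ∪ {none}}`.
  let E : Bool → L.Term (V × Finset (Option (Fin d)) × Bool) := fun β =>
    Q.subst fun T => t.relabel fun v => (v, T, β)
  let r : L.Term (V × Finset (Option (Fin d)) × Bool) :=
    q.subst ![t.relabel fun v => (v, Finset.univ, false), E false, E true]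
  let b' : V × Finset (Option (Fin d)) × Bool → A := fun p => mix blk a b p.2.1 p.1
  let a' : V × Finset (Option (Fin d)) × Bool → A := fun p =>
    if p.2.2 = true ∧ blk p.1 = none then b' p else a p.1
  let blk' : V × Finset (Option (Fin d)) × Bool → Option (Fin d) := fun p => blk p.1
  have h0 : ∀ S T, (mix blk' a' b' S ∘ fun v => (v, T, false)) = mix blk a b (S ∩ T) := by
    intro S T
    funext v
    by_cases h1 : blk v ∈ S <;> by_cases h2 : blk v ∈ T <;> simp [mix, blk', a', b', h1, h2]
  have h1 : ∀ S T, (mix blk' a' b' S ∘ fun v => (v, T, true)) =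
      mix blk a b (insert none S ∩ T) := by
    intro S T
    funext v
    by_cases h1 : blk v ∈ S <;> by_cases h2 : blk v ∈ T <;> by_cases h3 : blk v = none <;>
      simp_all [mix, blk', a', b']
  have hr : ∀ S, r.realize (mix blk' a' b' S) = q.realize ![c S, e S, e (insert none S)] := by
    intro S
    simp only [r]
    rw [Term.realize_subst]
    congr 1
    funext k
    fin_cases k <;> simp [E, e, c, Term.realize_relabel, Term.realize_subst, h0, h1]
  have hins : ∀ S : Finset (Fin d), insert none (S.map .some) = S.insertNone := by
    intro S
    ext o
    cases o <;> simp
  have hmap : ∀ S : Finset (Fin d), S.map .some ≠ Finset.univ := fun S hS => by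
    have := hS ▸ Finset.mem_univ (none : Option (Fin d))
    simp at this
  have hrmap : ∀ S : Finset (Fin d),
      r.realize (mix blk' a' b' (S.map .some)) = e S.insertNone := by
    intro S
    rw [hr, he _ (hmap S), (hq _ _).2, hins]
  have hlast := h.realize_mix_eq r blk' a' b' fun S hS => by
    have hS' : S.insertNone ≠ Finset.univ := fun h' => hS <| by
      rw [Finset.eq_univ_iff_forall] at h' ⊢
      exact fun i => Finset.some_mem_insertNone.1 (h' (some i))
    rw [hrmap, hr, he _ hS', (hq _ _).2, Finset.insert_eq_of_mem Finset.none_mem_insertNone,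
      he _ hS']
  have huniv : (Finset.univ : Finset (Fin d)).insertNone = Finset.univ := by
    ext o; cases o <;> simp
  rw [hrmap, huniv, hr, Finset.insert_eq_of_mem (Finset.mem_univ _), (hq _ _).1] at hlast
  have hb : mix blk a b Finset.univ = b := by funext v; simp [mix]
  simpa [e, c, hb] using hlast

end Cube

/-! ### The recursion for the height -/

section Recursion

variable {L : FirstOrder.Language} {A : Type*} [L.Structure A] [Finite A]

/-- If `ρ` takes at most `m` values, then identifying the variables of a term along `ρ` yields a
term operation of height at most `Ht(m)`. -/
theorem exists_height_le_maxHeight_of_card_le {n m : ℕ} (hn : 0 < n) (hm : 0 < m)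
    (t : L.Term (Fin n)) (ρ : Fin n → Fin n) (hρ : (Finset.univ.image ρ).card ≤ m) :
    ∃ s : L.Term (Fin n),
      (∀ x : Fin n → A, s.realize x = t.realize (x ∘ ρ)) ∧ height s ≤ maxHeight L A m := by
  -- Factor `ρ` as `κ ∘ π` with `π : Fin n → Fin m`.
  let f : {x // x ∈ Finset.univ.image ρ} → Fin m := fun y =>
    Fin.castLE hρ ((Finset.univ.image ρ).equivFin y)
  have hf : f.Injective := (Fin.castLE_injective hρ).comp (Equiv.injective _)
  let π : Fin n → Fin m := fun i => f ⟨ρ i, Finset.mem_image_of_mem ρ (Finset.mem_univ i)⟩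
  let κ : Fin m → Fin n := Function.extend f Subtype.val fun _ => ⟨0, hn⟩
  have hκ : κ ∘ π = ρ := by
    funext i
    exact hf.extend_apply Subtype.val (fun _ => ⟨0, hn⟩) ⟨ρ i, _⟩
  obtain ⟨s, hs, hle⟩ := exists_height_le_maxHeight (A := A) hm (t.relabel π)
  refine ⟨s.relabel κ, fun x => ?_, (height_relabel κ s).trans_le hle⟩
  rw [Term.realize_relabel, hs, Term.realize_relabel, Function.comp_assoc, hκ]

theorem div_le_card_filter_mod_eq (n K i : ℕ) (hi : i < K) :
    n / K ≤ (Finset.univ.filter fun j : Fin n => (j : ℕ) % K = i).card := by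
  have hlt : ∀ l : Fin (n / K), l * K + i < n := fun l => by
    have h1 : (l + 1) * K ≤ n / K * K := Nat.mul_le_mul_right K l.2
    have h2 := Nat.div_mul_le_self n K
    rw [add_mul, one_mul] at h1
    omega
  have hK : 0 < K := by omega
  calc n / K = (Finset.univ : Finset (Fin (n / K))).card := by simp
    _ ≤ _ := Finset.card_le_card_of_injOn (fun l => ⟨l * K + i, hlt l⟩)
      (fun l _ => by simp [Nat.mod_eq_of_lt hi]) fun l _ l' _ h => by
        simpa [Fin.ext_iff, hK.ne'] using h

theorem maxHeight_le_add_maxHeight {d : ℕ} (h : IsSupernilpotentOfDegree L A d)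
    (hM : IsMalcev L A) : ∃ C : ℕ, ∀ n, 0 < n →
      maxHeight L A n ≤ C + maxHeight L A (n - n / (d + 1) + 1) := by
  obtain ⟨Q, hdep, hQ⟩ := hM.exists_cubeTerm (I := (Finset.univ : Finset (Option (Fin d))))
    Finset.univ_nonempty
  simp only [Finset.ssubset_univ_iff, Finset.mem_univ, true_imp_iff] at hdep hQ
  refine ⟨height Q, fun n hn => ?_⟩
  obtain ⟨_, ⟨t, rfl⟩, ht⟩ := (maxHeight_isGreatest L A hn).1
  rw [← ht]
  let z : Fin n := ⟨0, hn⟩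
  -- The blocks are the residue classes modulo `d + 1`; `ρ T` identifies all variables outside the
  -- blocks in `T` with the first one, which serves as the base point since `A` need not have
  -- constant term operations.
  let blk : Fin n → Option (Fin d) := fun j =>
    finSuccEquiv d ⟨j % (d + 1), Nat.mod_lt _ d.succ_pos⟩
  let ρ : Finset (Option (Fin d)) → Fin n → Fin n := fun T j => if blk j ∈ T then j else z
  have hρ : ∀ T, T ≠ Finset.univ → (Finset.univ.image (ρ T)).card ≤ n - n / (d + 1) + 1 := by
    intro T hT
    obtain ⟨i, hi⟩ : ∃ i, i ∉ T := by simpa [Finset.eq_univ_iff_forall] using hT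
    let B : Finset (Fin n) :=
      Finset.univ.filter fun j => (j : ℕ) % (d + 1) = ((finSuccEquiv d).symm i : ℕ)
    have hsub : Finset.univ.image (ρ T) ⊆ insert z Bᶜ := by
      intro y hy
      obtain ⟨j, -, rfl⟩ := Finset.mem_image.1 hy
      by_cases hj : blk j ∈ T
      · refine Finset.mem_insert_of_mem (Finset.mem_compl.2 fun hB => hi ?_)
        simp only [ρ, if_pos hj, B, Finset.mem_filter, Finset.mem_univ, true_and] at hB
        have : blk j = i := by
          rw [← Equiv.eq_symm_apply]
          exact Fin.ext hB
        rwa [← this]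
      · simp [ρ, hj]
    have hB : n / (d + 1) ≤ B.card := div_le_card_filter_mod_eq n (d + 1) _ (Fin.is_lt _)
    have h1 := (Finset.card_le_card hsub).trans (Finset.card_insert_le _ _)
    rw [Finset.card_compl, Fintype.card_fin] at h1
    omega
  have hs : ∀ T, ∃ s : L.Term (Fin n),
      (T ≠ Finset.univ → ∀ x : Fin n → A, s.realize x = t.realize (x ∘ ρ T)) ∧
        height s ≤ maxHeight L A (n - n / (d + 1) + 1) := by
    intro T
    by_cases hT : T = Finset.univ
    -- `Q` does not depend on the variable `univ`, so any term of height `0` does.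
    · exact ⟨.var z, fun h => absurd hT h, Nat.zero_le _⟩
    · obtain ⟨s, hs, hle⟩ := exists_height_le_maxHeight_of_card_le (A := A) hn
        (Nat.succ_pos _) t (ρ T) (hρ T hT)
      exact ⟨s, fun _ => hs, hle⟩
  choose s hs hle using hs
  refine le_trans (Nat.sInf_le ⟨Q.subst s, ?_, rfl⟩) (height_subst_le Q s hle)
  funext x
  rw [Term.realize_subst, ← realize_cubeTerm h hM hQ t blk (fun _ => x z) x]
  refine hdep _ _ fun T hT => ?_
  rw [hs T hT]
  congr 1
  funext j
  by_cases hj : blk j ∈ T <;> simp [ρ, mix, hj]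

end Recursion

/-! ### Logarithmic growth -/

/-- A function that grows by at most a constant while its argument shrinks to
`n - ⌊n / K⌋ + 1` is bounded by a logarithm. -/
theorem exists_le_log_of_le_add {H : ℕ → ℕ} {K C : ℕ} (hK : 0 < K)
    (hH : ∀ n, 0 < n → H n ≤ C + H (n - n / K + 1)) :
    ∃ c₁ c₂ : ℝ, 0 < c₁ ∧ 0 < c₂ ∧ ∀ n : ℕ, 1 ≤ n → (H n : ℝ) ≤ c₁ * Real.log n + c₂ := by
  have hK' : (0 : ℝ) < K := by exact_mod_cast hK
  refine ⟨2 * K * (C + 1), 1 + (∑ k ∈ Finset.range (4 * K), H k : ℕ), by positivity, by positivity,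
    fun n hn => ?_⟩
  induction n using Nat.strong_induction_on with
  | _ n ih =>
  rcases lt_or_ge n (4 * K) with hlt | hge
  · have h1 : H n ≤ ∑ k ∈ Finset.range (4 * K), H k :=
      Finset.single_le_sum (f := H) (fun _ _ => Nat.zero_le _) (Finset.mem_range.2 hlt)
    have h2 : (H n : ℝ) ≤ (∑ k ∈ Finset.range (4 * K), H k : ℕ) := by exact_mod_cast h1
    have h3 : 0 ≤ 2 * K * (C + 1) * Real.log n :=
      mul_nonneg (by positivity) (Real.log_natCast_nonneg n)
    linarith
  · have h4 : 4 ≤ n / K := (Nat.le_div_iff_mul_le hK).2 hge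
    have hle : n / K ≤ n := Nat.div_le_self n K
    have hn' : (0 : ℝ) < n := by exact_mod_cast hn
    set m := n - n / K + 1 with hm
    -- As `n ≥ 4K`, the bounds `n / K - 1 ≤ ⌊n / K⌋` and `2 ≤ n / (2K)` give `m ≤ n - n / (2K)`.
    have hmn : (m : ℝ) / n ≤ 1 - 1 / (2 * K) := by
      have h5 : (n : ℝ) / K - 1 ≤ (n / K : ℕ) := by
        have h6 := (Nat.lt_div_mul_add hK (a := n)).le
        have h7 : (n : ℝ) ≤ (n / K : ℕ) * K + K := by exact_mod_cast h6
        rw [sub_le_iff_le_add, div_le_iff₀ hK']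
        linarith
      have h8 : (4 : ℝ) ≤ n / K := by
        rw [le_div_iff₀ hK']
        exact_mod_cast hge
      have h9 : (m : ℝ) = n - (n / K : ℕ) + 1 := by
        rw [hm]
        push_cast [Nat.cast_sub hle]
        ring
      rw [div_le_iff₀ hn', h9]
      have h10 : (1 - 1 / (2 * K)) * (n : ℝ) = n - n / K / 2 := by
        field_simp
      linarith
    have hm0 : (0 : ℝ) < m := by positivity
    have hlog : Real.log m ≤ Real.log n - 1 / (2 * K) := by
      have := Real.log_le_sub_one_of_pos (div_pos hm0 hn')
      rw [Real.log_div hm0.ne' hn'.ne'] at this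
      linarith
    have h11 : (H n : ℝ) ≤ C + H m := by exact_mod_cast hH n hn
    have h12 := ih m (by omega) (by omega)
    have h13 : 2 * K * (C + 1) * Real.log m ≤ 2 * K * (C + 1) * Real.log n - (C + 1) := by
      calc 2 * K * (C + 1) * Real.log m
          ≤ 2 * K * (C + 1) * (Real.log n - 1 / (2 * K)) :=
            mul_le_mul_of_nonneg_left hlog (by positivity)
        _ = _ := by field_simp
    linarith

end SupernilpotentHeight

theorem mainTheorem6 (L : FirstOrder.Language) [L.IsAlgebraic] (A : Type*) [L.Structure A]
    [Finite A] [Nonempty A] (hsn : SupernilpotentHeight.IsSupernilpotent L A)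
    (hM : SupernilpotentHeight.IsMalcev L A) :
    ∃ c₁ c₂ : ℝ, 0 < c₁ ∧ 0 < c₂ ∧ ∀ n : ℕ, 1 ≤ n →
      (SupernilpotentHeight.maxHeight L A n : ℝ) ≤ c₁ * Real.log n + c₂ := by
  obtain ⟨d, -, hd⟩ := hsn
  obtain ⟨C, hC⟩ := SupernilpotentHeight.maxHeight_le_add_maxHeight hd hM
  exact SupernilpotentHeight.exists_le_log_of_le_add d.succ_pos hC
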